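/- Let $R$ be a Noetherian normal domain of characteristic $p>0$ with fraction field $K$, and assume $R$ is F-finite (the Frobenius map of $R$ is finite). Throughout, $q=p^e$ with $e\ge 0$. For a $\mathbb{Q}$-Weil divisor $D$ on $\operatorname{Spec} R$ put $R(D)=\{x\in K \mid \operatorname{div}_R(x)+D\ge 0\}$ (with $0\in R(D)$), and let $\lceil D\rceil$ be the coefficientwise round-up. $R(D)^{1/q}$ denotes the set of $q$-th roots of elements of $R(D)$, regarded as an $R$-module; equivalently it is ${}^eR(D)$, i.e. $R(D)$ with $r\in R$ acting as multiplication by $r^q$. For $m\in R(D)$ we say that $m^{1/q}R\hookrightarrow R(D)^{1/q}$ splits if the $R$-linear map $R\to R(D)^{1/q}$, $1\mapsto m^{1/q}$, has an $R$-linear left inverse. A domain $A$ of characteristic $p$ is strongly F-regular if for every nonzero $d\in A$ there is $q$ such that $A\to A^{1/q}$, $1\mapsto d^{1/q}$, splits. For an effective $\mathbb{Q}$-Weil divisor $\Delta$, the pair $(R,\Delta)$ is strongly F-regular if for every nonzero $d\in R$ there is $q$ such that $d^{1/q}R\hookrightarrow R((q-1)\Delta)^{1/q}$ splits. For $R$-modules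 $N\subseteq M$, the $\Delta$-tight closure $N_M^{*\Delta}$ is the set of $z\in M$ for which there is a nonzero $d\in R$ such that, for all $q=p^e\gg 0$, $z\otimes d\in M\otimes_R {}^eR((q-1)\Delta)$ lies in the image of $N\otimes_R {}^eR((q-1)\Delta)$; for an ideal $I$ write $I^{*\Delta}=I_R^{*\Delta}$ and let $I^{[q]}$ be the ideal generated by the $q$-th powers of the elements of $I$. A nonzero $d\in R$ is a $\Delta$-test element if for every ideal $I$ of $R$ and every $x\in R$, $$x\in I^{*\Delta}\iff d\,x^q\in I^{[q]}R(\lceil q\Delta\rceil)\ \text{ for all } q=p^e .$$ Let $c\in R$ be any nonzero element such that the localization $R_c$ is strongly F-regular. Then: (1) For every effective $\mathbb{Q}$-Weil divisor $\Delta$ on $\operatorname{Spec} R$, the pair $(R,\Delta)$ is strongly F-regular if and only if there exists $q=p^e$ such that $c^{1/q}R\hookrightarrow R(\lceil q\Delta\rceil)^{1/q}$ splits as an $R$-module homomorphism. (2) For every effective $\mathbb{Q}$-Weil divisor $\Delta$ on $\operatorname{Spec} R$, $c^n$ is a $\Delta$-test element for some positive integer $n$. -/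

import Mathlib

open scoped WithZero TensorProduct

noncomputable section

namespace DeltaTC

/-! ### Prime divisors and their valuations -/

/-- The prime divisors of `Spec R`: the prime ideals of height one. -/
def PrimeDivisor (R : Type*) [CommRing R] : Type _ :=
  {P : PrimeSpectrum R // P.asIdeal.height = 1}

/-- The localization of `R` at a prime divisor. -/
abbrev PrimeDivisor.LocalRing {R : Type*} [CommRing R] (P : PrimeDivisor R) : Type _ :=
  Localization.AtPrime P.1.asIdeal

section Valuation

variable {R : Type*} [CommRing R] [IsDomain R] [IsNoetherianRing R] [IsIntegrallyClosed R]

instance isDomain_localRing (P : PrimeDivisor R) : IsDomain P.LocalRing :=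
  IsLocalization.isDomain_localization P.1.asIdeal.primeCompl_le_nonZeroDivisors

/-- A Noetherian normal domain is regular in codimension one. -/
instance isDiscreteValuationRing_localRing (P : PrimeDivisor R) :
    IsDiscreteValuationRing P.LocalRing := by
  have hdim : ringKrullDim P.LocalRing = 1 := by
    rw [IsLocalization.AtPrime.ringKrullDim_eq_height P.1.asIdeal P.LocalRing, P.2]
    rfl
  have hN : IsNoetherianRing P.LocalRing :=
    IsLocalization.isNoetherianRing P.1.asIdeal.primeCompl _ inferInstance
  have hI : IsIntegrallyClosed P.LocalRing :=
    isIntegrallyClosed_of_isLocalization _ P.1.asIdeal.primeCompl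
      P.1.asIdeal.primeCompl_le_nonZeroDivisors
  have hD : Ring.KrullDimLE 1 P.LocalRing := by
    rw [Ring.krullDimLE_iff, hdim]
    rfl
  have hF : ¬ IsField P.LocalRing := fun h => by
    rw [ringKrullDim_eq_zero_of_isField h] at hdim
    exact zero_ne_one hdim
  have hM : Ring.DimensionLEOne P.LocalRing :=
    ⟨fun {I} hI hp => (Ring.krullDimLE_one_iff_of_noZeroDivisors.mp hD I hI hp)⟩
  have hDed : IsDedekindDomain P.LocalRing := { hN, hM, hI with }
  exact ((IsDiscreteValuationRing.TFAE P.LocalRing hF).out 0 2).mpr hDed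

/-- The (multiplicatively written) valuation of the discrete valuation ring `R_P`, on `R`. -/
def PrimeDivisor.intValuation (P : PrimeDivisor R) : Valuation R ℤᵐ⁰ :=
  (IsDiscreteValuationRing.maximalIdeal P.LocalRing).intValuation.comap (algebraMap R P.LocalRing)

theorem PrimeDivisor.intValuation_ne_zero (P : PrimeDivisor R) {r : R} (hr : r ≠ 0) :
    P.intValuation r ≠ 0 := by
  rw [PrimeDivisor.intValuation, Valuation.comap_apply]
  apply IsDedekindDomain.HeightOneSpectrum.intValuation_ne_zero
  exact (map_ne_zero_iff _ (IsLocalization.injective P.LocalRing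
    P.1.asIdeal.primeCompl_le_nonZeroDivisors)).mpr hr

theorem PrimeDivisor.nonZeroDivisors_le (P : PrimeDivisor R) :
    nonZeroDivisors R ≤ P.intValuation.supp.primeCompl := fun _ hr h =>
  P.intValuation_ne_zero (nonZeroDivisors.ne_zero hr) h

/-- The (multiplicatively written) valuation of `K = Frac R` belonging to the discrete valuation
ring `R_P`. -/
def PrimeDivisor.valuation (K : Type*) [Field K] [Algebra R K] [IsFractionRing R K]
    (P : PrimeDivisor R) : Valuation K ℤᵐ⁰ :=
  P.intValuation.extendToLocalization P.nonZeroDivisors_le K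

/-- The additive order `v_P(x)` of a nonzero `x : K` at `P`, i.e. the coefficient of `P` in
`div_R(x)`. (The value at `x = 0` is junk and never used.) -/
def PrimeDivisor.ord {K : Type*} [Field K] [Algebra R K] [IsFractionRing R K]
    (P : PrimeDivisor R) (x : K) : ℤ :=
  -WithZero.log (P.valuation K x)

end Valuation

/-! ### `ℚ`-Weil divisors and the modules `R(D)` -/

/-- `ℚ`-Weil divisors on `Spec R`; `D` is effective iff `0 ≤ D`. -/
abbrev QDivisor (R : Type*) [CommRing R] : Type _ := PrimeDivisor R →₀ ℚ

/-- The round-up `⌈D⌉`. -/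
def roundUp {R : Type*} [CommRing R] (D : QDivisor R) : QDivisor R :=
  D.mapRange (fun a => ((⌈a⌉ : ℤ) : ℚ)) (by simp)

section Sections

variable {R : Type*} [CommRing R] [IsDomain R] [IsNoetherianRing R] [IsIntegrallyClosed R]
variable (K : Type*) [Field K] [Algebra R K] [IsFractionRing R K]

theorem PrimeDivisor.valuation_algebraMap_le_one (P : PrimeDivisor R) (r : R) :
    P.valuation K (algebraMap R K r) ≤ 1 := by
  rw [PrimeDivisor.valuation, Valuation.extendToLocalization_apply_map_apply]
  exact IsDedekindDomain.HeightOneSpectrum.intValuation_le_one _ _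

variable {K}

theorem PrimeDivisor.ord_algebraMap_nonneg (P : PrimeDivisor R) (r : R) :
    0 ≤ P.ord (algebraMap R K r) := by
  have h := P.valuation_algebraMap_le_one K r
  rw [PrimeDivisor.ord]
  by_cases h0 : P.valuation K (algebraMap R K r) = 0
  · simp [h0]
  · have := (WithZero.log_le_log h0 one_ne_zero).mpr h
    simpa using this

theorem PrimeDivisor.ord_mul (P : PrimeDivisor R) {x y : K} (hx : x ≠ 0) (hy : y ≠ 0) :
    P.ord (x * y) = P.ord x + P.ord y := by
  have hx' := (Valuation.ne_zero_iff (P.valuation K)).mpr hx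
  have hy' := (Valuation.ne_zero_iff (P.valuation K)).mpr hy
  simp only [PrimeDivisor.ord, map_mul, WithZero.log_mul hx' hy']
  ring

theorem PrimeDivisor.min_le_ord_add (P : PrimeDivisor R) {x y : K} (hx : x ≠ 0) (hy : y ≠ 0)
    (hxy : x + y ≠ 0) : min (P.ord x) (P.ord y) ≤ P.ord (x + y) := by
  have hx' := (Valuation.ne_zero_iff (P.valuation K)).mpr hx
  have hy' := (Valuation.ne_zero_iff (P.valuation K)).mpr hy
  have hxy' := (Valuation.ne_zero_iff (P.valuation K)).mpr hxy
  simp only [PrimeDivisor.ord]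
  rcases le_max_iff.mp ((P.valuation K).map_add x y) with h | h
  · have := (WithZero.log_le_log hxy' hx').mpr h
    omega
  · have := (WithZero.log_le_log hxy' hy').mpr h
    omega

variable (K)

/-- `R(D) = {x ∈ K | div_R(x) + D ≥ 0}` (containing `0`), as an `R`-submodule of `K`. -/
def sections (D : QDivisor R) : Submodule R K where
  carrier := {x | x = 0 ∨ ∀ P : PrimeDivisor R, 0 ≤ (P.ord x : ℚ) + D P}
  zero_mem' := Or.inl rfl
  add_mem' := by
    intro x y hx hy
    by_cases hx0 : x = 0
    · simpa [hx0] using hy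
    by_cases hy0 : y = 0
    · simpa [hy0] using hx
    by_cases hxy : x + y = 0
    · exact Or.inl hxy
    refine Or.inr fun P => ?_
    have h1 := (hx.resolve_left hx0) P
    have h2 := (hy.resolve_left hy0) P
    have h3 := P.min_le_ord_add hx0 hy0 hxy
    rcases min_le_iff.mp h3 with h | h
    · have : (P.ord x : ℚ) ≤ P.ord (x + y) := by exact_mod_cast h
      linarith
    · have : (P.ord y : ℚ) ≤ P.ord (x + y) := by exact_mod_cast h
      linarith
  smul_mem' := by
    intro r x hx
    by_cases hx0 : x = 0
    · exact Or.inl (by simp [hx0])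
    by_cases hr0 : algebraMap R K r = 0
    · exact Or.inl (by simp [Algebra.smul_def, hr0])
    refine Or.inr fun P => ?_
    have h1 := (hx.resolve_left hx0) P
    have h2 : (0 : ℚ) ≤ P.ord (algebraMap R K r) := by
      exact_mod_cast P.ord_algebraMap_nonneg (K := K) r
    rw [Algebra.smul_def, P.ord_mul hr0 hx0]
    push_cast
    linarith

/-- For effective `D` one has `R ⊆ R(D)`. -/
theorem algebraMap_mem_sections {D : QDivisor R} (hD : 0 ≤ D) (r : R) :
    algebraMap R K r ∈ sections K D := by
  refine Or.inr fun P => add_nonneg ?_ (hD P)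
  exact_mod_cast P.ord_algebraMap_nonneg (K := K) r

/-- An element of `R` viewed in `R(D)`, for effective `D`. -/
def toSections {D : QDivisor R} (hD : 0 ≤ D) (r : R) : sections K D :=
  ⟨algebraMap R K r, algebraMap_mem_sections K hD r⟩

end Sections

theorem roundUp_nonneg {R : Type*} [CommRing R] {D : QDivisor R} (hD : 0 ≤ D) :
    0 ≤ roundUp D := by
  intro P
  have h : (0 : ℤ) ≤ ⌈D P⌉ := Int.ceil_nonneg (hD P)
  simpa [roundUp] using h

theorem pow_smul_nonneg {R : Type*} [CommRing R] (p e : ℕ) {D : QDivisor R} (hD : 0 ≤ D) :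
    0 ≤ ((p : ℚ) ^ e) • D :=
  smul_nonneg (by positivity) hD

theorem pow_sub_one_smul_nonneg {R : Type*} [CommRing R] (p e : ℕ) [hp : Fact p.Prime]
    {D : QDivisor R} (hD : 0 ≤ D) : 0 ≤ ((p : ℚ) ^ e - 1) • D :=
  smul_nonneg (sub_nonneg.mpr (one_le_pow₀ (by exact_mod_cast hp.out.one_le))) hD

/-! ### Frobenius -/

/-- `R` is F-finite: the Frobenius `R → R` (equivalently `R ↪ R^{1/p}`) is a finite map. -/
def FFinite (p : ℕ) (R : Type*) [CommRing R] [Fact p.Prime] [CharP R p] : Prop :=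
  (frobenius R p).Finite

/-- `ᵉM`: the additive group `M` on which `R` acts through the `e`-th iterate of Frobenius,
`r • m = r^(p^e) m`. For `M = R(D)` this is the `R`-module `R(D)^{1/q}`, `q = p^e`, the element
`m` standing for `m^{1/q}`. -/
def FrobTwist (_p _e : ℕ) (M : Type*) : Type _ := M

instance FrobTwist.addCommGroup (p e : ℕ) (M : Type*) [AddCommGroup M] : AddCommGroup (FrobTwist p e M) :=
  inferInstanceAs (AddCommGroup M)

instance FrobTwist.module (p e : ℕ) (R M : Type*) [CommRing R] [Fact p.Prime] [CharP R p] [AddCommGroup M]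
    [Module R M] : Module R (FrobTwist p e M) :=
  letI : Module R M := Module.compHom M (iterateFrobenius R p e)
  inferInstanceAs (Module R M)

/-- The identity map `M → ᵉM`, `m ↦ m^{1/q}`. -/
def FrobTwist.of (p e : ℕ) {M : Type*} [AddCommGroup M] : M ≃+ FrobTwist p e M :=
  AddEquiv.refl M

theorem FrobTwist.smul_of (p e : ℕ) {R M : Type*} [CommRing R] [Fact p.Prime] [CharP R p]
    [AddCommGroup M] [Module R M] (r : R) (m : M) :
    r • FrobTwist.of p e m = FrobTwist.of p e (r ^ p ^ e • m) := by
  rw [← iterateFrobenius_def]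
  rfl

/-- The `R`-linear map `R → M^{1/q}`, `1 ↦ m^{1/q}`, where `q = p^e`, splits. -/
def RootSplits (p e : ℕ) (R : Type*) {M : Type*} [CommRing R] [Fact p.Prime] [CharP R p]
    [AddCommGroup M] [Module R M] (m : M) : Prop :=
  ∃ φ : FrobTwist p e M →ₗ[R] R,
    φ ∘ₗ LinearMap.toSpanSingleton R (FrobTwist p e M) (FrobTwist.of p e m) = LinearMap.id

/-- A domain `R` is strongly F-regular: for every `c ≠ 0` there is `q = p^e` such that
`R → R^{1/q}`, `1 ↦ c^{1/q}`, splits. -/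
def IsStronglyFRegular (p : ℕ) (R : Type*) [CommRing R] [Fact p.Prime] [CharP R p] : Prop :=
  ∀ c : R, c ≠ 0 → ∃ e : ℕ, RootSplits p e R c

/-- The localization `R_c` of a domain of characteristic `p` at `c ≠ 0` has characteristic `p`. -/
theorem charP_away (p : ℕ) {R : Type*} [CommRing R] [IsDomain R] [CharP R p] {c : R}
    (hc : c ≠ 0) : CharP (Localization.Away c) p :=
  charP_of_injective_algebraMap
    (IsLocalization.injective (Localization.Away c) (M := Submonoid.powers c)
      (powers_le_nonZeroDivisors_of_noZeroDivisors hc)) p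

/-- `I^{[q]}`: the ideal generated by the `q`-th powers of the elements of `I`. -/
def bracketPower {R : Type*} [CommRing R] (I : Ideal R) (q : ℕ) : Ideal R :=
  Ideal.span ((fun a => a ^ q) '' (I : Set R))

/-! ### Strong F-regularity of pairs, `Δ`-tight closure and `Δ`-test elements -/

section Pairs

variable (p : ℕ) [Fact p.Prime] {R : Type*} [CommRing R] [IsDomain R] [IsNoetherianRing R]
  [IsIntegrallyClosed R] [CharP R p]
variable (K : Type*) [Field K] [Algebra R K] [IsFractionRing R K]

/-- `(R, Δ)` is strongly F-regular: for every `c ≠ 0` there is `q = p^e` such that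
`R → R((q-1)Δ)^{1/q}`, `1 ↦ c^{1/q}`, splits. -/
def IsStronglyFRegularPair {Δ : QDivisor R} (hΔ : 0 ≤ Δ) : Prop :=
  ∀ c : R, c ≠ 0 → ∃ e : ℕ, RootSplits p e R (toSections K (pow_sub_one_smul_nonneg p e hΔ) c)

/-- `ᵉR((q-1)Δ)`. -/
abbrev FrobSections (Δ : QDivisor R) (e : ℕ) : Type _ :=
  FrobTwist p e (sections K (((p : ℚ) ^ e - 1) • Δ))

variable {M : Type*} [AddCommGroup M] [Module R M]

/-- `N_M^{[q]Δ}`: the image of `N ⊗ ᵉR((q-1)Δ) → M ⊗ ᵉR((q-1)Δ)`. -/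
def frobPower (Δ : QDivisor R) (N : Submodule R M) (e : ℕ) :
    Submodule R (M ⊗[R] FrobSections p K Δ e) :=
  LinearMap.range (N.subtype.rTensor (FrobSections p K Δ e))

/-- The `Δ`-tight closure `N_M^{*Δ}`: those `z ∈ M` for which there is `c ≠ 0` in `R` with
`c z^q = z ⊗ c ∈ N_M^{[q]Δ}` for all `q = p^e ≫ 0`. -/
def tightClosure {Δ : QDivisor R} (hΔ : 0 ≤ Δ) (N : Submodule R M) : Set M :=
  {z | ∃ c : R, c ≠ 0 ∧ ∃ e₀ : ℕ, ∀ e ≥ e₀,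
    z ⊗ₜ[R] FrobTwist.of p e (toSections K (pow_sub_one_smul_nonneg p e hΔ) c)
      ∈ frobPower p K Δ N e}

/-- `c` is a `Δ`-test element. -/
def IsTestElement {Δ : QDivisor R} (hΔ : 0 ≤ Δ) (c : R) : Prop :=
  c ≠ 0 ∧ ∀ (I : Ideal R) (x : R),
    x ∈ tightClosure p K hΔ I ↔
      ∀ e : ℕ, algebraMap R K (c * x ^ p ^ e) ∈
        bracketPower I (p ^ e) • sections K (roundUp (((p : ℚ) ^ e) • Δ))

end Pairs

end DeltaTC

end

namespace DeltaTC

/-! ### Prime divisors -/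

/-! Every `R`-linear map `R(D)^{1/q} → R` with `D` effective extends to an additive `φ : K → K` with
`φ (a ^ q * x) = a * φ x`. Such maps compose, multiplying the `q`s, so the proof is a calculus of
maps on `K`. Three facts carry it. (a) `IsCartierMap.map_mem_sections`: if `φ` preserves `R` and `D
≤ q⌈E⌉` with `E ≥ 0`, then `φ` sends `R(D)` into `R(⌈E⌉)`. This is a check at each prime divisor,
and `(qq' - 1)Δ ≤ q'⌈qΔ⌉` lets maps that know nothing of `Δ` act on its sections. (b)
`exists_uniform_exponent`: one `n`, depending only on `c`, such that every `d ≠ 0` is sent to `c ^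
n` by maps preserving `R` with `q` arbitrarily large. F-finiteness clears the denominators of a
splitting over `R_c`, giving `d ↦ c ^ N` with `N` depending on `d`; iterates of one fixed map then
absorb `N`. (c) `exists_mul_mem_sections`: some `d ≠ 0` multiplies `R(⌈qΔ⌉)` into `R((q-1)Δ)` for
all `q`. For (1), a splitting of `dc` preceded by multiplication by `d` splits `c`. Conversely,
iterating a splitting of `c` splits some `c ^ s` with `s ≥ n`, and (b) carries any element to `c ^
n`. For (2), applying the map of (b) to the tight closure relation at `qq'` gives the test relation
at `q`; (c) gives the converse. -/

theorem PrimeDivisor.algebraMap_localRing_injective {R : Type*} [CommRing R] [IsDomain R]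
    (P : PrimeDivisor R) : Function.Injective (algebraMap R P.LocalRing) :=
  IsLocalization.injective P.LocalRing P.1.asIdeal.primeCompl_le_nonZeroDivisors

section Valuation

variable {R : Type*} [CommRing R] [IsDomain R] [IsNoetherianRing R] [IsIntegrallyClosed R]

theorem PrimeDivisor.intValuation_eq_one (P : PrimeDivisor R) {s : R} (hs : s ∉ P.1.asIdeal) :
    P.intValuation s = 1 := by
  rw [PrimeDivisor.intValuation, Valuation.comap_apply,
    IsDedekindDomain.HeightOneSpectrum.intValuation_eq_one_iff]
  exact fun h => hs ((IsLocalization.AtPrime.to_map_mem_maximal_iff P.LocalRing P.1.asIdeal s).mp h)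

theorem PrimeDivisor.exists_intValuation_eq (P : PrimeDivisor R) :
    ∃ t : R, P.intValuation t = WithZero.exp (-1 : ℤ) := by
  obtain ⟨π, hπ⟩ :=
    (IsDiscreteValuationRing.maximalIdeal P.LocalRing).intValuation_exists_uniformizer
  obtain ⟨⟨a, s⟩, h⟩ := IsLocalization.surj P.1.asIdeal.primeCompl π
  refine ⟨a, ?_⟩
  have hs := P.intValuation_eq_one s.2
  rw [PrimeDivisor.intValuation, Valuation.comap_apply] at hs ⊢
  rw [← h, map_mul, hs, hπ, mul_one]

variable (K : Type*) [Field K] [Algebra R K] [IsFractionRing R K]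

theorem PrimeDivisor.valuation_algebraMap (P : PrimeDivisor R) (r : R) :
    P.valuation K (algebraMap R K r) = P.intValuation r :=
  Valuation.extendToLocalization_apply_map_apply ..

variable {K}

theorem PrimeDivisor.ord_algebraMap_eq_zero (P : PrimeDivisor R) {s : R} (hs : s ∉ P.1.asIdeal) :
    P.ord (algebraMap R K s) = 0 := by
  rw [PrimeDivisor.ord, P.valuation_algebraMap K, P.intValuation_eq_one hs]
  simp

theorem PrimeDivisor.ord_pow (P : PrimeDivisor R) (x : K) (n : ℕ) :
    P.ord (x ^ n) = n * P.ord x := by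
  simp [PrimeDivisor.ord]

variable (K) in
theorem PrimeDivisor.exists_ord_eq_one (P : PrimeDivisor R) :
    ∃ t : R, t ≠ 0 ∧ P.ord (algebraMap R K t) = 1 := by
  obtain ⟨t, ht⟩ := P.exists_intValuation_eq
  refine ⟨t, ?_, ?_⟩
  · rintro rfl
    rw [map_zero] at ht
    exact WithZero.exp_ne_zero ht.symm
  · rw [PrimeDivisor.ord, P.valuation_algebraMap K, ht]
    simp

/-- An element of nonnegative order at `P` lies in `R_P`. -/
theorem PrimeDivisor.exists_mul_mem_range (P : PrimeDivisor R) {x : K} (hx : x ≠ 0)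
    (h : 0 ≤ P.ord x) :
    ∃ s ∉ P.1.asIdeal, algebraMap R K s * x ∈ (algebraMap R K).range := by
  obtain ⟨a, b, hb, rfl⟩ := IsFractionRing.div_surjective (A := R) x
  have hb0 : algebraMap R K b ≠ 0 :=
    (map_ne_zero_iff _ (IsFractionRing.injective R K)).mpr (nonZeroDivisors.ne_zero hb)
  have ha0 : algebraMap R K a ≠ 0 := fun h0 => hx (by simp [h0])
  suffices hdvd : algebraMap R P.LocalRing b ∣ algebraMap R P.LocalRing a by
    obtain ⟨u, hu⟩ := hdvd
    obtain ⟨⟨r, s⟩, hrs⟩ := IsLocalization.surj P.1.asIdeal.primeCompl u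
    refine ⟨s, s.2, r, ?_⟩
    have : (s : R) * a = b * r := by
      apply P.algebraMap_localRing_injective
      rw [map_mul, map_mul, hu, ← hrs]
      ring
    rw [mul_div_assoc', eq_div_iff hb0, ← map_mul, ← map_mul, this, mul_comm]
  rcases ValuationRing.dvd_total (algebraMap R P.LocalRing b) (algebraMap R P.LocalRing a) with
    hd | ⟨u, hu⟩
  · exact hd
  -- Here `b = a * u` in `R_P`; since `a / b` has nonnegative order, `u` must be a unit, so `b`
  -- divides `a` after all.
  have hu1 : (IsDiscreteValuationRing.maximalIdeal P.LocalRing).intValuation u = 1 := by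
    refine le_antisymm (IsDedekindDomain.HeightOneSpectrum.intValuation_le_one _ _) ?_
    have hab : P.ord (algebraMap R K b) ≤ P.ord (algebraMap R K a) := by
      have h1 := P.ord_mul (div_ne_zero ha0 hb0) hb0
      rw [div_mul_cancel₀ _ hb0] at h1
      omega
    rw [PrimeDivisor.ord, PrimeDivisor.ord, neg_le_neg_iff, WithZero.log_le_log
      ((P.valuation K).ne_zero_iff.mpr ha0) ((P.valuation K).ne_zero_iff.mpr hb0),
      P.valuation_algebraMap K, P.valuation_algebraMap K, PrimeDivisor.intValuation,
      Valuation.comap_apply, Valuation.comap_apply, hu, map_mul] at hab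
    refine (le_mul_iff_one_le_right (zero_lt_iff.mpr ?_)).mp hab
    apply IsDedekindDomain.HeightOneSpectrum.intValuation_ne_zero
    exact (map_ne_zero_iff _ P.algebraMap_localRing_injective).mpr fun h0 => ha0 (by simp [h0])
  rw [IsDedekindDomain.HeightOneSpectrum.intValuation_eq_one_iff] at hu1
  have hunit : IsUnit u := by
    by_contra hn
    exact hu1 ((IsLocalRing.mem_maximalIdeal u).mpr hn)
  rw [hu]
  exact (hunit.dvd_mul_right.mp dvd_rfl : _ * u ∣ _)

end Valuation

/-! ### Round-ups and the modules `R(D)` -/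

section Divisors

variable {R : Type*} [CommRing R]

@[simp]
theorem roundUp_apply (D : QDivisor R) (P : PrimeDivisor R) : roundUp D P = (⌈D P⌉ : ℤ) := by
  simp [roundUp]

theorem roundUp_smul_le (q : ℕ) (D : QDivisor R) :
    roundUp ((q : ℚ) • D) ≤ (q : ℚ) • roundUp D := fun P => by
  rw [Finsupp.smul_apply, roundUp_apply, roundUp_apply, Finsupp.smul_apply, smul_eq_mul,
    smul_eq_mul]
  have : ⌈(q : ℚ) * D P⌉ ≤ q * ⌈D P⌉ := by
    rw [Int.ceil_le]
    push_cast
    exact mul_le_mul_of_nonneg_left (Int.le_ceil _) (by positivity)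
  exact_mod_cast this

variable [IsDomain R] [IsNoetherianRing R] [IsIntegrallyClosed R]
variable (K : Type*) [Field K] [Algebra R K] [IsFractionRing R K]

/-- There is a nonzero element of `R` whose divisor is at least `D + 1` on the support of `D`. -/
theorem exists_add_one_le_ord (D : QDivisor R) :
    ∃ d : R, d ≠ 0 ∧ ∀ P ∈ D.support, D P + 1 ≤ P.ord (algebraMap R K d) := by
  classical
  choose t ht0 ht1 using PrimeDivisor.exists_ord_eq_one (R := R) K
  -- A power of a uniformizer at each `P`; the other factors of the product lie in `R` and can only
  -- raise the order at `P`.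
  let f : PrimeDivisor R → R := fun P => t P ^ (⌈D P⌉.toNat + 1)
  have hf : ∀ s : Finset (PrimeDivisor R), ∏ P ∈ s, f P ≠ 0 := fun s =>
    Finset.prod_ne_zero_iff.mpr fun P _ => pow_ne_zero _ (ht0 P)
  have hinj := IsFractionRing.injective R K
  refine ⟨∏ P ∈ D.support, f P, hf _, fun P hP => ?_⟩
  have h1 : ((⌈D P⌉.toNat + 1 : ℕ) : ℤ) ≤ P.ord (algebraMap R K (∏ P ∈ D.support, f P)) := by
    rw [← Finset.mul_prod_erase _ _ hP, map_mul, P.ord_mul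
      ((map_ne_zero_iff _ hinj).mpr (pow_ne_zero _ (ht0 P)))
      ((map_ne_zero_iff _ hinj).mpr (hf _)), map_pow, P.ord_pow, ht1, mul_one]
    exact le_add_of_nonneg_right (P.ord_algebraMap_nonneg _)
  have h2 : ⌈D P⌉ + 1 ≤ P.ord (algebraMap R K (∏ P ∈ D.support, f P)) := by
    have := Int.self_le_toNat ⌈D P⌉
    rw [Nat.cast_succ] at h1
    omega
  have h3 : (⌈D P⌉ : ℚ) + 1 ≤ P.ord (algebraMap R K (∏ P ∈ D.support, f P)) := by
    exact_mod_cast h2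
  linarith [Int.le_ceil (D P)]

/-- Multiplication by a suitable nonzero element of `R` absorbs the rounding, uniformly in `q`. -/
theorem exists_mul_mem_sections (D : QDivisor R) :
    ∃ d : R, d ≠ 0 ∧ ∀ (q : ℚ), ∀ x ∈ sections K (roundUp (q • D)),
      algebraMap R K d * x ∈ sections K ((q - 1) • D) := by
  obtain ⟨d, hd0, hd⟩ := exists_add_one_le_ord K D
  refine ⟨d, hd0, fun q x hx => ?_⟩
  by_cases hx0 : x = 0
  · exact Or.inl (by simp [hx0])
  refine Or.inr fun P => ?_
  have h1 := (hx.resolve_left hx0) P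
  rw [roundUp_apply, Finsupp.smul_apply, smul_eq_mul] at h1
  rw [P.ord_mul ((map_ne_zero_iff _ (IsFractionRing.injective R K)).mpr hd0) hx0,
    Finsupp.smul_apply, smul_eq_mul, Int.cast_add]
  by_cases hP : P ∈ D.support
  -- Rounding costs less than `1` and passing from `q` to `q - 1` costs `D P`; `d` pays for both.
  · linarith [hd P hP, Int.ceil_lt_add_one (q * D P)]
  · rw [Finsupp.notMem_support_iff] at hP
    have : (0 : ℚ) ≤ P.ord (algebraMap R K d) :=
      Int.cast_nonneg (P.ord_algebraMap_nonneg d)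
    rw [hP, mul_zero, Int.ceil_zero, Int.cast_zero] at h1
    rw [hP, mul_zero]
    linarith

end Divisors

/-! ### Root-linear maps -/

/-- `φ` is additive with `φ (a ^ q * x) = a * φ x`, that is, it is a `K`-linear map
`K^{1/q} → K`. -/
def IsRootLinear {K : Type*} [Field K] (q : ℕ) (φ : K →+ K) : Prop :=
  ∀ a x, φ (a ^ q * x) = a * φ x

/-- `φ` is root-linear and maps `R` into itself. -/
structure IsCartierMap (R : Type*) {K : Type*} [CommRing R] [Field K] [Algebra R K] (q : ℕ)
    (φ : K →+ K) : Prop where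
  root_linear : IsRootLinear q φ
  map_range (r : R) : φ (algebraMap R K r) ∈ (algebraMap R K).range

section RootLinear

variable {R K : Type*} [CommRing R] [Field K] [Algebra R K] {q q' : ℕ} {φ ψ : K →+ K}

theorem IsRootLinear.comp (hφ : IsRootLinear q φ) (hψ : IsRootLinear q' ψ) :
    IsRootLinear (q * q') (φ.comp ψ) := fun a x => by
  rw [AddMonoidHom.comp_apply, AddMonoidHom.comp_apply, pow_mul, hψ, hφ]

theorem IsCartierMap.comp (hφ : IsCartierMap R q φ) (hψ : IsCartierMap R q' ψ) :
    IsCartierMap R (q * q') (φ.comp ψ) where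
  root_linear := hφ.root_linear.comp hψ.root_linear
  map_range r := by
    obtain ⟨s, hs⟩ := hψ.map_range r
    rw [AddMonoidHom.comp_apply, ← hs]
    exact hφ.map_range s

/-- The case `q = 1`: multiplications by elements of `R` join the calculus, and composition with
them leaves `q` unchanged. -/
theorem isCartierMap_mulLeft (a : R) :
    IsCartierMap R 1 (AddMonoidHom.mulLeft (algebraMap R K a)) where
  root_linear b x := by
    simp only [AddMonoidHom.coe_mulLeft]
    ring
  map_range r := ⟨a * r, by simp⟩

theorem IsRootLinear.premul (hφ : IsRootLinear q φ) (a : K) :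
    IsRootLinear q (φ.comp (AddMonoidHom.mulLeft a)) := fun b x => by
  simp only [AddMonoidHom.comp_apply, AddMonoidHom.coe_mulLeft, mul_left_comm a, hφ b]

theorem IsCartierMap.premul (hφ : IsCartierMap R q φ) (a : R) :
    IsCartierMap R q (φ.comp (AddMonoidHom.mulLeft (algebraMap R K a))) := by
  simpa using hφ.comp (isCartierMap_mulLeft a)

/-- If `φ` is root-linear with `φ 1 = b`, then maps taking `1` to `b ^ 2` exist for all powers
of `q`. -/
theorem IsCartierMap.exists_pow_map_one (hφ : IsCartierMap R q φ) (hq : 2 ≤ q) {b : R}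
    (hb : φ 1 = algebraMap R K b) (k : ℕ) :
    ∃ ψ : K →+ K, IsCartierMap R (q ^ k) ψ ∧ ψ 1 = algebraMap R K b ^ 2 := by
  induction k with
  | zero => exact ⟨_, by simpa using isCartierMap_mulLeft (b ^ 2), by simp⟩
  | succ k ih =>
    obtain ⟨ψ, hψ, h1⟩ := ih
    -- The square is a fixed point: `φ (b ^ (q - 2) * b ^ 2) = φ (b ^ q * 1) = b * φ 1 = b ^ 2`.
    refine ⟨_, by simpa [pow_succ'] using (hφ.premul (b ^ (q - 2))).comp hψ, ?_⟩
    simp only [AddMonoidHom.comp_apply, AddMonoidHom.coe_mulLeft, h1]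
    rw [← pow_add, Nat.sub_add_cancel hq, ← mul_one (_ ^ q), hφ.root_linear, hb, sq]

variable [IsDomain R] [IsNoetherianRing R] [IsIntegrallyClosed R] [IsFractionRing R K]

/-- Membership is tested at one `P` at a time. With `t` a uniformizer and `n = ⌈E P⌉`, the element
`t ^ (n * q) * x` lies in `R_P`, and root-linearity turns the factor `t ^ (n * q)` into `t ^ n` in
front of `φ x`. Effectivity of `E` makes `n` a natural number. -/
theorem IsCartierMap.map_mem_sections (hφ : IsCartierMap R q φ) {D E : QDivisor R} (hE : 0 ≤ E)
    (hDE : D ≤ (q : ℚ) • roundUp E) {x : K} (hx : x ∈ sections K D) :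
    φ x ∈ sections K (roundUp E) := by
  by_cases hφx : φ x = 0
  · exact Or.inl hφx
  have hx0 : x ≠ 0 := fun h => hφx (by simp [h])
  refine Or.inr fun P => ?_
  obtain ⟨t, ht0, ht1⟩ := P.exists_ord_eq_one K
  have hinj := IsFractionRing.injective R K
  have ht0' : algebraMap R K t ≠ 0 := (map_ne_zero_iff _ hinj).mpr ht0
  obtain ⟨n, hn⟩ := Int.eq_ofNat_of_zero_le (Int.ceil_nonneg (hE P))
  have h1 := (hx.resolve_left hx0) P
  have h2 := hDE P
  rw [Finsupp.smul_apply, roundUp_apply, hn, smul_eq_mul] at h2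
  have h3 : 0 ≤ P.ord ((algebraMap R K t ^ n) ^ q * x) := by
    rw [P.ord_mul (pow_ne_zero _ (pow_ne_zero _ ht0')) hx0, P.ord_pow, P.ord_pow, ht1]
    have h4 : (0 : ℚ) ≤ P.ord x + q * (n : ℤ) := by linarith
    have h5 : 0 ≤ P.ord x + q * (n : ℤ) := by exact_mod_cast h4
    linarith
  obtain ⟨s, hs, r, hr⟩ := P.exists_mul_mem_range
    (mul_ne_zero (pow_ne_zero _ (pow_ne_zero _ ht0')) hx0) h3
  have hs0 : algebraMap R K s ≠ 0 :=
    (map_ne_zero_iff _ hinj).mpr fun h => hs (h ▸ P.1.asIdeal.zero_mem)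
  -- For `q = 0`, root-linearity at `a = 0` gives `φ x = 0`, since `0 ^ 0 = 1`.
  by_cases hq : q = 0
  · subst hq
    have h6 := hφ.root_linear 0 x
    simp [hφx] at h6
  -- The factor `s ^ (q - 1)` completes the denominator to a `q`-th power, so that `s * t ^ n * φ x`
  -- lies in `R`; as `s` is a unit at `P`, the order of `φ x` is at least `-n`.
  obtain ⟨r', hr'⟩ := hφ.map_range (s ^ (q - 1) * r)
  have h7 : algebraMap R K (s ^ (q - 1) * r) = (algebraMap R K s * algebraMap R K t ^ n) ^ q * x := by
    rw [map_mul, hr, map_pow, mul_pow]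
    nth_rewrite 3 [← Nat.sub_add_cancel (Nat.one_le_iff_ne_zero.mpr hq)]
    rw [pow_succ]
    ring
  rw [h7, hφ.root_linear] at hr'
  have h8 := P.ord_algebraMap_nonneg (K := K) r'
  rw [hr', P.ord_mul (mul_ne_zero hs0 (pow_ne_zero _ ht0')) hφx,
    P.ord_mul hs0 (pow_ne_zero _ ht0'), P.ord_algebraMap_eq_zero hs, P.ord_pow, ht1] at h8
  rw [roundUp_apply, hn]
  have h9 : 0 ≤ P.ord (φ x) + n := by linarith
  exact_mod_cast h9

end RootLinear

/-! ### Splittings and root-linear maps -/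

section Splitting

variable {p : ℕ} [Fact p.Prime] {R : Type*} [CommRing R] [CharP R p]

theorem FrobTwist.smul_def (e : ℕ) {M : Type*} [AddCommGroup M] [Module R M] (r : R)
    (m : FrobTwist p e M) :
    (FrobTwist.of p e).symm (r • m) = r ^ p ^ e • (FrobTwist.of p e).symm m := by
  obtain ⟨m, rfl⟩ := (FrobTwist.of p e).surjective m
  rw [FrobTwist.smul_of, AddEquiv.symm_apply_apply, AddEquiv.symm_apply_apply]

/-- A linear map `M → N`, seen as a linear map `ᵉM → ᵉN`. -/
def FrobTwist.map (p e : ℕ) [Fact p.Prime] [CharP R p] {M N : Type*} [AddCommGroup M] [Module R M]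
    [AddCommGroup N] [Module R N] (g : M →ₗ[R] N) : FrobTwist p e M →ₗ[R] FrobTwist p e N where
  toFun m := FrobTwist.of p e (g ((FrobTwist.of p e).symm m))
  map_add' m n := by simp
  map_smul' r m := by
    rw [FrobTwist.smul_def, map_smul, ← FrobTwist.smul_of, RingHom.id_apply]

theorem rootSplits_iff {e : ℕ} {M : Type*} [AddCommGroup M] [Module R M] {m : M} :
    RootSplits p e R m ↔ ∃ φ : FrobTwist p e M →ₗ[R] R, φ (FrobTwist.of p e m) = 1 := by
  refine exists_congr fun φ => ⟨fun h => by simpa using LinearMap.congr_fun h 1, fun h => ?_⟩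
  ext
  simpa using h

variable {K : Type*} [Field K] [Algebra R K] [IsFractionRing R K]

/-- For `R ⊆ M ⊆ K`, inverting the nonzero elements of `R` turns `M^{1/q}` into `K^{1/q}`; the
universal property then extends maps from `M^{1/q}` to `K^{1/q}`. -/
theorem isLocalizedModule_frobTwist_map (e : ℕ) {M : Type*} [AddCommGroup M] [Module R M]
    (g : M →ₗ[R] K) (hg : Function.Injective g) (hR : ∀ r : R, ∃ m, g m = algebraMap R K r) :
    IsLocalizedModule (nonZeroDivisors R) (FrobTwist.map p e g) where
  map_units s := by
    have hs : algebraMap R K s ^ p ^ e ≠ 0 :=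
      pow_ne_zero _ (IsLocalization.map_units K s).ne_zero
    rw [Module.End.isUnit_iff]
    constructor
    · intro x y hxy
      have h := congrArg (FrobTwist.of p e).symm hxy
      simp only [Module.algebraMap_end_apply, FrobTwist.smul_def, Algebra.smul_def, map_pow] at h
      exact (FrobTwist.of p e).symm.injective (mul_left_cancel₀ hs h)
    · intro y
      refine ⟨FrobTwist.of p e ((algebraMap R K s ^ p ^ e)⁻¹ * (FrobTwist.of p e).symm y), ?_⟩
      rw [Module.algebraMap_end_apply, FrobTwist.smul_of, Algebra.smul_def, map_pow,
        mul_inv_cancel_left₀ hs, AddEquiv.apply_symm_apply]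
  surj y := by
    obtain ⟨⟨r, s⟩, h⟩ := IsLocalization.surj (nonZeroDivisors R) ((FrobTwist.of p e).symm y)
    -- Since `s` acts as `s ^ q`, the fraction `r / s` is rewritten as `s ^ (q - 1) * r / s ^ q`.
    obtain ⟨m, hm⟩ := hR ((s : R) ^ (p ^ e - 1) * r)
    refine ⟨⟨FrobTwist.of p e m, s⟩, (FrobTwist.of p e).symm.injective ?_⟩
    have hq : 1 ≤ p ^ e := Nat.one_le_pow _ _ (Fact.out : p.Prime).pos
    simp only [Submonoid.smul_def, FrobTwist.smul_def, FrobTwist.map, LinearMap.coe_mk,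
      AddHom.coe_mk, AddEquiv.symm_apply_apply, hm, Algebra.smul_def]
    rw [map_mul, ← h]
    nth_rewrite 1 [← Nat.sub_add_cancel hq]
    rw [pow_succ, map_mul]
    ring
  exists_of_eq {x y} h := by
    refine ⟨1, ?_⟩
    have : x = y := (FrobTwist.of p e).symm.injective (hg ((FrobTwist.of p e).injective h))
    rw [this]

/-- An `R`-linear map `M^{1/q} → R`, for `R ⊆ M ⊆ K`, extends to `K^{1/q} → K`. -/
theorem exists_rootLinear_extension {e : ℕ} {M : Type*} [AddCommGroup M] [Module R M]
    (g : M →ₗ[R] K) (hg : Function.Injective g) (hR : ∀ r : R, ∃ m, g m = algebraMap R K r)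
    (φ : FrobTwist p e M →ₗ[R] R) :
    ∃ Φ : K →+ K, IsRootLinear (p ^ e) Φ ∧
      ∀ m, Φ (g m) = algebraMap R K (φ (FrobTwist.of p e m)) := by
  have hloc := isLocalizedModule_frobTwist_map (p := p) e g hg hR
  have hunits : ∀ s : nonZeroDivisors R, IsUnit (algebraMap R (Module.End R K) s) := fun s => by
    have hs : algebraMap R K s ≠ 0 := (IsLocalization.map_units K s).ne_zero
    rw [Module.End.isUnit_iff]
    refine ⟨fun x y hxy => ?_, fun y => ⟨(algebraMap R K s)⁻¹ * y, ?_⟩⟩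
    · simp only [Module.algebraMap_end_apply, Algebra.smul_def] at hxy
      exact mul_left_cancel₀ hs hxy
    · rw [Module.algebraMap_end_apply, Algebra.smul_def, mul_inv_cancel_left₀ hs]
  let L : FrobTwist p e K →ₗ[R] K := IsLocalizedModule.lift (nonZeroDivisors R)
    (FrobTwist.map p e g) (Algebra.linearMap R K ∘ₗ φ) hunits
  have hL : ∀ (r : R) (x : K), L (FrobTwist.of p e (algebraMap R K r ^ p ^ e * x)) =
      algebraMap R K r * L (FrobTwist.of p e x) := fun r x => by
    rw [← map_pow, ← Algebra.smul_def, ← FrobTwist.smul_of, map_smul, Algebra.smul_def]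
  refine ⟨L.toAddMonoidHom.comp (FrobTwist.of p e).toAddMonoidHom, fun a x => ?_, fun m => ?_⟩
  · obtain ⟨⟨r, s⟩, h⟩ := IsLocalization.surj (nonZeroDivisors R) a
    refine mul_left_cancel₀ (IsLocalization.map_units K s).ne_zero ?_
    change _ * L (FrobTwist.of p e _) = _ * (a * L (FrobTwist.of p e _))
    rw [← hL, ← mul_assoc, ← mul_pow, ← mul_assoc, mul_comm _ a, h, hL]
  · exact IsLocalizedModule.lift_apply (nonZeroDivisors R) (FrobTwist.map p e g)
      (Algebra.linearMap R K ∘ₗ φ) hunits (FrobTwist.of p e m)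

theorem exists_isCartierMap_extension {e : ℕ} (φ : FrobTwist p e R →ₗ[R] R) :
    ∃ Φ : K →+ K, IsCartierMap R (p ^ e) Φ ∧
      ∀ r, Φ (algebraMap R K r) = algebraMap R K (φ (FrobTwist.of p e r)) := by
  obtain ⟨Φ, h1, h2⟩ := exists_rootLinear_extension (Algebra.linearMap R K)
    (IsFractionRing.injective R K) (fun r => ⟨r, rfl⟩) φ
  exact ⟨Φ, ⟨h1, fun r => ⟨_, (h2 r).symm⟩⟩, h2⟩

/-- A root-linear map that maps the submodule `N` of `K` into `R` and `m` to `1` gives a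
splitting. -/
theorem IsRootLinear.rootSplits {e : ℕ} {Φ : K →+ K} (hΦ : IsRootLinear (p ^ e) Φ)
    {N : Submodule R K} (hN : ∀ x ∈ N, Φ x ∈ (algebraMap R K).range) {m : N} (hm : Φ m = 1) :
    RootSplits p e R m := by
  have hinj := IsFractionRing.injective R K
  choose f hf using fun x : N => hN x x.2
  rw [rootSplits_iff]
  refine ⟨{ toFun := fun x => f ((FrobTwist.of p e).symm x)
            map_add' := fun x y => hinj ?_
            map_smul' := fun r x => hinj ?_ }, hinj ?_⟩
  · simp [hf]
  · rw [hf, FrobTwist.smul_def, Submodule.coe_smul, Algebra.smul_def, map_pow, hΦ, RingHom.id_apply,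
      smul_eq_mul, map_mul, hf]
  · simp [hf, hm]

end Splitting

/-! ### Strong F-regularity of a localization -/

section Localization

variable {p : ℕ} [Fact p.Prime]

/-- A strongly F-regular domain has a splitting of `S → S^{1/q}` with `q > 1`. -/
theorem IsStronglyFRegular.exists_isCartierMap {S : Type*} [CommRing S] [IsDomain S] [CharP S p]
    {K : Type*} [Field K] [Algebra S K] [IsFractionRing S K] (h : IsStronglyFRegular p S) :
    ∃ e : ℕ, 0 < e ∧ ∃ Φ : K →+ K, IsCartierMap S (p ^ e) Φ ∧ Φ 1 = 1 := by
  -- A field has no nonzero nonunit to force `e > 0`, but there Frobenius splits by linear algebra.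
  by_cases hS : IsField S
  · let _ := hS.toField
    have hker : LinearMap.ker (LinearMap.toSpanSingleton S (FrobTwist p 1 S)
        (FrobTwist.of p 1 (1 : S))) = ⊥ := by
      rw [LinearMap.ker_eq_bot']
      intro s hs
      have := congrArg (FrobTwist.of p 1).symm hs
      rw [LinearMap.toSpanSingleton_apply, FrobTwist.smul_of, AddEquiv.symm_apply_apply,
        smul_eq_mul, mul_one, map_zero] at this
      exact pow_eq_zero_iff (pow_ne_zero _ (Fact.out : p.Prime).ne_zero) |>.mp this
    obtain ⟨φ, hφ⟩ := LinearMap.exists_leftInverse_of_injective _ hker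
    obtain ⟨Φ, h1, h2⟩ := exists_isCartierMap_extension (K := K) φ
    refine ⟨1, one_pos, Φ, h1, ?_⟩
    have h3 := LinearMap.congr_fun hφ 1
    rw [LinearMap.comp_apply, LinearMap.toSpanSingleton_apply, one_smul, LinearMap.id_apply] at h3
    rw [← map_one (algebraMap S K), h2, h3]
  · obtain ⟨d, hd0, hd⟩ := Ring.exists_not_isUnit_of_not_isField hS
    obtain ⟨e, he⟩ := h d hd0
    obtain ⟨φ, hφ⟩ := rootSplits_iff.mp he
    obtain ⟨Φ, h1, h2⟩ := exists_isCartierMap_extension (K := K) φ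
    refine ⟨e, Nat.pos_of_ne_zero ?_, _, h1.premul d, by simp [h2, hφ]⟩
    -- For `e = 0` the splitting would read `d * φ 1 = 1`, making `d` a unit.
    rintro rfl
    refine hd (IsUnit.of_mul_eq_one (φ (FrobTwist.of p 0 (1 : S))) ?_)
    rw [← smul_eq_mul, ← map_smul, FrobTwist.smul_of]
    simpa using hφ

/-- Finiteness as an induction principle: a property stable under sums and under the action of `A`
need only be checked on finitely many generators. -/
theorem _root_.RingHom.Finite.exists_finset {A B : Type*} [CommRing A] [CommRing B] {f : A →+* B}
    (hf : f.Finite) : ∃ s : Finset B, ∀ C : AddSubmonoid B, (∀ g ∈ s, g ∈ C) →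
      (∀ a, ∀ x ∈ C, f a * x ∈ C) → ∀ x, x ∈ C := by
  let _ := f.toAlgebra
  have hfin : Module.Finite A B := hf
  obtain ⟨s, hs⟩ := hfin.fg_top
  refine ⟨s, fun C hg hsmul x => ?_⟩
  have hx : x ∈ Submodule.span A (s : Set B) := by
    rw [hs]
    trivial
  induction hx using Submodule.span_induction with
  | mem g h => exact hg g h
  | zero => exact C.zero_mem
  | add x y _ _ hx hy => exact C.add_mem hx hy
  | smul a x _ hx => exact hsmul a x hx

theorem FFinite.iterateFrobenius_finite {R : Type*} [CommRing R] [CharP R p] (h : FFinite p R)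
    (e : ℕ) : (iterateFrobenius R p e).Finite := by
  induction e with
  | zero =>
    rw [iterateFrobenius_zero]
    exact RingHom.Finite.id R
  | succ e ih =>
    rw [iterateFrobenius_add, iterateFrobenius_one]
    exact ih.comp h

/-- Clearing denominators. -/
theorem FFinite.exists_pow_mul_mem_range {R : Type*} [CommRing R] [CharP R p]
    {K : Type*} [Field K] [Algebra R K] (hF : FFinite p R) {e : ℕ} {c : R} {Φ : K →+ K}
    (hΦ : IsRootLinear (p ^ e) Φ)
    (hc : ∀ r : R, ∃ N : ℕ, algebraMap R K c ^ N * Φ (algebraMap R K r) ∈ (algebraMap R K).range) :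
    ∃ N : ℕ, IsCartierMap R (p ^ e)
      ((AddMonoidHom.mulLeft (algebraMap R K (c ^ N))).comp Φ) := by
  obtain ⟨s, hs⟩ := (hF.iterateFrobenius_finite e).exists_finset
  choose n hn using hc
  refine ⟨∑ g ∈ s, n g, by
    simpa only [one_mul] using (isCartierMap_mulLeft (c ^ _)).root_linear.comp hΦ, ?_⟩
  -- The elements `r` with `c ^ N * Φ r ∈ R` are closed under sums and under multiplication by
  -- `q`-th powers. The sum of the exponents of the generators serves all of them at once.
  refine hs (((algebraMap R K).range.toAddSubgroup.toAddSubmonoid).comap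
    (((AddMonoidHom.mulLeft (algebraMap R K (c ^ ∑ g ∈ s, n g))).comp Φ).comp
      (algebraMap R K : R →+ K))) (fun g hg => ?_) (fun a x hx => ?_)
  · obtain ⟨k, hk⟩ := Nat.exists_eq_add_of_le (Finset.single_le_sum (f := n) (by simp) hg)
    obtain ⟨r', hr'⟩ := hn g
    refine ⟨c ^ k * r', ?_⟩
    simp only [AddMonoidHom.comp_apply, AddMonoidHom.coe_mulLeft, AddMonoidHom.coe_coe]
    rw [hk, map_mul, hr', map_pow, map_pow]
    ring
  · obtain ⟨r', hr'⟩ := hx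
    refine ⟨a * r', ?_⟩
    simp only [AddMonoidHom.comp_apply, AddMonoidHom.coe_mulLeft, AddMonoidHom.coe_coe] at hr' ⊢
    rw [iterateFrobenius_def, map_mul, map_mul, map_pow _ a, hΦ, hr']
    ring

variable {R : Type*} [CommRing R] [IsDomain R] [CharP R p]
variable {K : Type*} [Field K] [Algebra R K] [IsFractionRing R K]

/-- A power of `c` which is the image of every nonzero `d` under suitable maps `R^{1/q} → R`. -/
theorem exists_uniform_exponent (hF : FFinite p R) {c : R} (hc : c ≠ 0)
    (hreg : haveI := charP_away p hc
      IsStronglyFRegular p (Localization.Away c)) :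
    ∃ n : ℕ, 0 < n ∧ ∀ d : R, d ≠ 0 → ∀ E : ℕ, ∃ e ≥ E, ∃ χ : K →+ K,
      IsCartierMap R (p ^ e) χ ∧ χ (algebraMap R K d) = algebraMap R K c ^ n := by
  have := charP_away p hc
  have hle := powers_le_nonZeroDivisors_of_noZeroDivisors hc
  let _ : Algebra (Localization.Away c) K :=
    IsLocalization.localizationAlgebraOfSubmonoidLe _ K (Submonoid.powers c) (nonZeroDivisors R) hle
  have : IsScalarTower R (Localization.Away c) K :=
    IsLocalization.localization_isScalarTower_of_submonoid_le _ K (Submonoid.powers c)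
      (nonZeroDivisors R) hle
  have : IsFractionRing (Localization.Away c) K :=
    IsFractionRing.isFractionRing_of_isDomain_of_isLocalization (Submonoid.powers c) _ K
  have : IsDomain (Localization.Away c) := IsLocalization.isDomain_localization hle
  have hmaps : ∀ {e : ℕ} {Φ : K →+ K}, IsCartierMap (Localization.Away c) (p ^ e) Φ →
      ∃ N : ℕ, IsCartierMap R (p ^ e)
        ((AddMonoidHom.mulLeft (algebraMap R K (c ^ N))).comp Φ) := fun {e Φ} hΦ => by
    refine hF.exists_pow_mul_mem_range hΦ.root_linear fun r => ?_
    obtain ⟨y, hy⟩ := hΦ.map_range (algebraMap R _ r)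
    obtain ⟨⟨a, _, N, rfl⟩, h⟩ := IsLocalization.surj (Submonoid.powers c) y
    refine ⟨N, a, ?_⟩
    rw [IsScalarTower.algebraMap_apply R (Localization.Away c) K r, ← hy,
      IsScalarTower.algebraMap_apply R (Localization.Away c) K a, ← h, map_mul,
      ← IsScalarTower.algebraMap_apply, map_pow, mul_comm]
  obtain ⟨e₁, he₁, Φ₁, hΦ₁, h1⟩ := hreg.exists_isCartierMap (K := K)
  obtain ⟨m, hm⟩ := hmaps hΦ₁
  have hp := (Fact.out : p.Prime).two_le
  have hq₁ : 2 ≤ p ^ e₁ := hp.trans (Nat.le_self_pow he₁.ne' p)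
  -- `2 * m` comes from `ψ 1 = (c ^ m) ^ 2`, and the extra `1` from one full `q`-th power of `c`
  -- pulled out of `ψ`.
  refine ⟨2 * m + 1, by omega, fun d hd E => ?_⟩
  obtain ⟨e, he⟩ := hreg (algebraMap R _ d)
    ((map_ne_zero_iff _ (IsLocalization.injective _ hle)).mpr hd)
  obtain ⟨φ, hφ⟩ := rootSplits_iff.mp he
  obtain ⟨Φ, hΦ, h2⟩ := exists_isCartierMap_extension (K := K) φ
  have h3 := h2 (algebraMap R _ d)
  rw [hφ, ← IsScalarTower.algebraMap_apply, map_one] at h3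
  obtain ⟨N, hN⟩ := hmaps hΦ
  -- With `N + E` iterations, `q = p ^ (e₁ * (N + E))` exceeds `N`, so `c ^ N` can be topped up to
  -- `c ^ q`, and the final exponent of `p` is at least `E`.
  obtain ⟨ψ, hψ, h4⟩ := hm.exists_pow_map_one hq₁ (b := c ^ m) (by simp [h1]) (N + E)
  rw [← pow_mul] at hψ
  have hlt : N + E < p ^ (e₁ * (N + E)) :=
    (Nat.le_mul_of_pos_left _ he₁).trans_lt (Nat.lt_pow_self hp)
  refine ⟨e₁ * (N + E) + e, ?_, _, by
    simpa [pow_add] using (hψ.premul (c ^ (p ^ (e₁ * (N + E)) - N))).comp hN, ?_⟩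
  · have := Nat.le_mul_of_pos_left (N + E) he₁
    omega
  · simp only [AddMonoidHom.comp_apply, AddMonoidHom.coe_mulLeft, h3, mul_one]
    rw [← pow_add, Nat.sub_add_cancel (by omega), ← mul_one (_ ^ p ^ _), hψ.root_linear, h4, map_pow]
    ring

end Localization

/-! ### Tensor products and products of ideals with `R(D)` -/

/-- The isomorphism `R ⊗ M ≅ M` carries the image of `I ⊗ M` onto `I M`. -/
theorem _root_.Ideal.tmul_mem_range_rTensor_iff {R M : Type*} [CommRing R] [AddCommGroup M]
    [Module R M] (I : Ideal R) (z : R) (m : M) :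
    z ⊗ₜ[R] m ∈ LinearMap.range (I.subtype.rTensor M) ↔ z • m ∈ (I • ⊤ : Submodule R M) := by
  rw [← I.subtype_rTensor_range M, LinearMap.range_comp, ← TensorProduct.lid_tmul]
  exact (TensorProduct.lid R M).injective.mem_set_image.symm

section Tensor

variable {p : ℕ} [Fact p.Prime] {R : Type*} [CommRing R] [CharP R p]

/-- On `ᵉN` an element of `I` acts as its `q`-th power, and these powers generate `I^{[q]}`. -/
theorem smul_top_frobTwist {K : Type*} [Field K] [Algebra R K] (e : ℕ) (I : Ideal R)
    (N : Submodule R K) (m : N) :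
    FrobTwist.of p e m ∈ (I • ⊤ : Submodule R (FrobTwist p e N)) ↔
      (m : K) ∈ bracketPower I (p ^ e) • N := by
  constructor
  · intro h
    suffices ∀ y ∈ (I • ⊤ : Submodule R (FrobTwist p e N)),
        (((FrobTwist.of p e).symm y : N) : K) ∈ bracketPower I (p ^ e) • N from this _ h
    intro y hy
    induction hy using Submodule.smul_induction_on' with
    | smul r hr n _ =>
      rw [FrobTwist.smul_def, Submodule.coe_smul]
      exact Submodule.smul_mem_smul (Ideal.subset_span ⟨r, hr, rfl⟩) (Subtype.prop _)
    | add x _ y _ hx hy =>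
      rw [map_add, Submodule.coe_add]
      exact add_mem hx hy
  · intro h
    suffices ∀ x ∈ bracketPower I (p ^ e) • N, ∀ hx : x ∈ N,
        FrobTwist.of p e (⟨x, hx⟩ : N) ∈ (I • ⊤ : Submodule R (FrobTwist p e N)) from
      this m h m.2
    have hle : ∀ x ∈ bracketPower I (p ^ e) • N, ∃ hx : x ∈ N,
        FrobTwist.of p e (⟨x, hx⟩ : N) ∈ (I • ⊤ : Submodule R (FrobTwist p e N)) := by
      intro x hx
      induction hx using Submodule.smul_induction_on' with
      | smul r hr n hn =>
        refine ⟨N.smul_mem _ hn, ?_⟩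
        unfold bracketPower at hr
        induction hr using Submodule.span_induction generalizing n with
        | mem r hr =>
          obtain ⟨a, ha, rfl⟩ := hr
          have := Submodule.smul_mem_smul ha
            (Submodule.mem_top (x := FrobTwist.of p e (⟨n, hn⟩ : N)))
          rwa [FrobTwist.smul_of] at this
        | zero =>
          convert zero_mem (I • ⊤ : Submodule R (FrobTwist p e N))
          rw [← map_zero (FrobTwist.of p e)]
          congr 1
          ext
          simp
        | add r s _ _ hr hs =>
          convert add_mem (hr n hn) (hs n hn)
          rw [← map_add]
          congr 1
          ext
          simp [add_smul]
        | smul a r _ hr =>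
          convert hr (a • n) (N.smul_mem _ hn) using 3
          rw [smul_smul, smul_eq_mul, mul_comm]
      | add x _ y _ hx hy =>
        obtain ⟨hx1, hx2⟩ := hx
        obtain ⟨hy1, hy2⟩ := hy
        exact ⟨add_mem hx1 hy1, add_mem hx2 hy2⟩
    exact fun x hx _ => (hle x hx).2

variable [IsDomain R] [IsNoetherianRing R] [IsIntegrallyClosed R]
variable (K : Type*) [Field K] [Algebra R K] [IsFractionRing R K]

theorem tmul_mem_frobPower_iff (Δ : QDivisor R) (I : Ideal R) (e : ℕ) (z : R)
    (m : sections K (((p : ℚ) ^ e - 1) • Δ)) :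
    z ⊗ₜ[R] FrobTwist.of p e m ∈ frobPower p K Δ I e ↔
      algebraMap R K (z ^ p ^ e) * m ∈
        bracketPower I (p ^ e) • sections K (((p : ℚ) ^ e - 1) • Δ) := by
  rw [frobPower, Ideal.tmul_mem_range_rTensor_iff, FrobTwist.smul_of, smul_top_frobTwist,
    Submodule.coe_smul, Algebra.smul_def (z ^ p ^ e)]

end Tensor

/-! ### The main results -/

/-- With `q = p ^ e` and `q' = p ^ e'`: `(qq' - 1)Δ ≤ qq'Δ ≤ q'⌈qΔ⌉`. This is the hypothesis of
`IsCartierMap.map_mem_sections` in both main results. -/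
theorem pow_sub_one_smul_le {R : Type*} [CommRing R] (p : ℕ) {Δ : QDivisor R} (hΔ : 0 ≤ Δ)
    (e e' : ℕ) :
    ((p : ℚ) ^ (e + e') - 1) • Δ ≤ ((p ^ e' : ℕ) : ℚ) • roundUp (((p : ℚ) ^ e) • Δ) := fun P => by
  have h1 := Int.le_ceil ((p : ℚ) ^ e * Δ P)
  have h2 := mul_le_mul_of_nonneg_left h1 (pow_nonneg (Nat.cast_nonneg p) e' : (0 : ℚ) ≤ _)
  have h3 := hΔ P
  simp only [Finsupp.smul_apply, roundUp_apply, smul_eq_mul, Nat.cast_pow, Finsupp.coe_zero,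
    Pi.zero_apply] at h3 ⊢
  rw [pow_add]
  linarith

section Main

variable {p : ℕ} [Fact p.Prime] {R : Type*} [CommRing R] [IsDomain R] [IsNoetherianRing R]
  [IsIntegrallyClosed R]
variable {K : Type*} [Field K] [Algebra R K] [IsFractionRing R K]

/-- Iterating a splitting of `c`. -/
theorem IsRootLinear.exists_iterate {Δ : QDivisor R} (hΔ : 0 ≤ Δ) {e : ℕ} {c : R} {φ : K →+ K}
    (hφ : IsRootLinear (p ^ e) φ)
    (hR : ∀ x ∈ sections K (roundUp (((p : ℚ) ^ e) • Δ)), φ x ∈ (algebraMap R K).range)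
    (hc : φ (algebraMap R K c) = 1) (k : ℕ) :
    ∃ (e' : ℕ) (Φ : K →+ K) (s : ℕ), IsRootLinear (p ^ e') Φ ∧
      (∀ x ∈ sections K (roundUp (((p : ℚ) ^ e') • Δ)), Φ x ∈ (algebraMap R K).range) ∧
      k ≤ s ∧ Φ (algebraMap R K c ^ s) = 1 := by
  induction k with
  | zero => exact ⟨e, φ, 1, hφ, hR, Nat.zero_le _, by rwa [pow_one]⟩
  | succ k ih =>
    obtain ⟨e', Φ, s, hΦ, hΦR, hks, hs⟩ := ih
    have hφ' : IsCartierMap R (p ^ e) φ :=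
      ⟨hφ, fun r => hR _ (algebraMap_mem_sections K
        (roundUp_nonneg (pow_smul_nonneg p e hΔ)) r)⟩
    -- With `q = p ^ e`: `φ (c ^ (q * s) * c) = c ^ s * φ c = c ^ s`, which `Φ` sends to `1`.
    refine ⟨e' + e, Φ.comp φ, p ^ e * s + 1, pow_add p e' e ▸ hΦ.comp hφ, fun x hx => ?_, ?_, ?_⟩
    · refine hΦR _ (hφ'.map_mem_sections (pow_smul_nonneg p e' hΔ) ?_ hx)
      have h := roundUp_smul_le (p ^ e) (((p : ℚ) ^ e') • Δ)
      rwa [smul_smul, Nat.cast_pow, ← pow_add, add_comm e e', ← Nat.cast_pow p e] at h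
    · have := Nat.le_mul_of_pos_left s (pow_pos (Fact.out : p.Prime).pos e)
      omega
    · rw [AddMonoidHom.comp_apply, pow_succ, mul_comm (p ^ e), pow_mul, hφ, hc, mul_one, hs]

variable [CharP R p]

theorem isStronglyFRegularPair_iff (hF : FFinite p R) {c : R} (hc : c ≠ 0)
    (hreg : haveI := charP_away p hc
      IsStronglyFRegular p (Localization.Away c)) {Δ : QDivisor R} (hΔ : 0 ≤ Δ) :
    IsStronglyFRegularPair p K hΔ ↔ ∃ e : ℕ, RootSplits p e R
      (toSections K (roundUp_nonneg (pow_smul_nonneg p e hΔ)) c) := by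
  constructor
  · intro h
    obtain ⟨d, hd0, hd⟩ := exists_mul_mem_sections K Δ
    obtain ⟨e, he⟩ := h (d * c) (mul_ne_zero hd0 hc)
    obtain ⟨φ, hφ⟩ := rootSplits_iff.mp he
    obtain ⟨Φ, hΦ, h1⟩ := exists_rootLinear_extension (sections K (((p : ℚ) ^ e - 1) • Δ)).subtype
      Subtype.val_injective (fun r => ⟨toSections K (pow_sub_one_smul_nonneg p e hΔ) r, rfl⟩) φ
    refine ⟨e, IsRootLinear.rootSplits (Φ := Φ.comp (AddMonoidHom.mulLeft (algebraMap R K d)))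
      ?_ (fun x hx => ?_) ?_⟩
    · exact hΦ.premul _
    · exact ⟨_, (h1 ⟨_, hd _ x hx⟩).symm⟩
    · have h2 := h1 (toSections K (pow_sub_one_smul_nonneg p e hΔ) (d * c))
      rw [hφ, map_one] at h2
      simpa [toSections] using h2
  · rintro ⟨e, he⟩ d hd
    obtain ⟨φ, hφ⟩ := rootSplits_iff.mp he
    obtain ⟨Φ, hΦ, h1⟩ := exists_rootLinear_extension
      (sections K (roundUp (((p : ℚ) ^ e) • Δ))).subtype Subtype.val_injective
      (fun r => ⟨toSections K (roundUp_nonneg (pow_smul_nonneg p e hΔ)) r, rfl⟩) φ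
    obtain ⟨n, -, hn⟩ := exists_uniform_exponent (K := K) hF hc hreg
    obtain ⟨e', -, χ, hχ, hχd⟩ := hn d hd 0
    obtain ⟨e₁, Ψ, s, hΨ, hΨR, hns, hs⟩ := hΦ.exists_iterate hΔ (c := c)
      (fun x hx => ⟨_, (h1 ⟨x, hx⟩).symm⟩) (by
        have h2 := h1 (toSections K (roundUp_nonneg (pow_smul_nonneg p e hΔ)) c)
        rw [hφ, map_one] at h2
        exact h2) n
    -- The composite runs `R((q-1)Δ) → R(⌈p ^ e₁ Δ⌉) → R(⌈p ^ e₁ Δ⌉) → R` with `q = p ^ (e₁ + e')`,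
    -- taking `d ↦ c ^ n ↦ c ^ s ↦ 1`.
    refine ⟨e₁ + e', IsRootLinear.rootSplits
      (Φ := (Ψ.comp (AddMonoidHom.mulLeft (algebraMap R K (c ^ (s - n))))).comp χ)
      ?_ (fun x hx => ?_) ?_⟩
    · rw [pow_add]
      exact (hΨ.premul _).comp hχ.root_linear
    · refine hΨR _ ?_
      have h3 := hχ.map_mem_sections (pow_smul_nonneg p e₁ hΔ) (pow_sub_one_smul_le p hΔ e₁ e') hx
      have h4 := (sections K (roundUp (((p : ℚ) ^ e₁) • Δ))).smul_mem (c ^ (s - n)) h3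
      rwa [Algebra.smul_def] at h4
    · change Ψ (algebraMap R K (c ^ (s - n)) * χ (algebraMap R K d)) = 1
      rw [hχd, map_pow, ← pow_add, Nat.sub_add_cancel hns, hs]

theorem exists_isTestElement_pow (hF : FFinite p R) {c : R} (hc : c ≠ 0)
    (hreg : haveI := charP_away p hc
      IsStronglyFRegular p (Localization.Away c)) {Δ : QDivisor R} (hΔ : 0 ≤ Δ) :
    ∃ n : ℕ, 0 < n ∧ IsTestElement p K hΔ (c ^ n) := by
  obtain ⟨n, hn0, hn⟩ := exists_uniform_exponent (K := K) hF hc hreg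
  refine ⟨n, hn0, pow_ne_zero _ hc, fun I x => ⟨?_, fun h => ?_⟩⟩
  · rintro ⟨d, hd0, e₀, hd⟩ e
    -- Taking `e' ≥ e₀` puts `e + e'` in the range where the tight closure relation holds, even for
    -- small `e`.
    obtain ⟨e', he', χ, hχ, hχd⟩ := hn d hd0 e₀
    have h1 := (tmul_mem_frobPower_iff K Δ I (e + e') x _).mp (hd (e + e') (by omega))
    have h2 : χ (algebraMap R K (x ^ p ^ (e + e')) * algebraMap R K d) =
        algebraMap R K (c ^ n * x ^ p ^ e) := by
      rw [pow_add, pow_mul, map_pow, hχ.root_linear, hχd, map_mul, mul_comm, map_pow _ c]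
    rw [← h2]
    change algebraMap R K (x ^ p ^ (e + e')) * algebraMap R K d ∈ _ at h1
    generalize algebraMap R K (x ^ p ^ (e + e')) * algebraMap R K d = y at h1 ⊢
    induction h1 using Submodule.smul_induction_on' with
    | smul r hr y hy =>
      unfold bracketPower at hr
      induction hr using Submodule.span_induction generalizing y with
      | mem r hr =>
        obtain ⟨a, ha, rfl⟩ := hr
        -- `χ` strips only `q' = p ^ e'` from the exponent, so it maps `I^{[qq']}R((qq'-1)Δ)` into
        -- `I^{[q]}R(⌈qΔ⌉)`.
        have h3 : χ (a ^ p ^ (e + e') • y) = a ^ p ^ e • χ y := by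
          rw [pow_add, pow_mul, Algebra.smul_def, map_pow, hχ.root_linear, Algebra.smul_def]
        rw [h3]
        exact Submodule.smul_mem_smul (Ideal.subset_span ⟨a, ha, rfl⟩)
          (hχ.map_mem_sections (pow_smul_nonneg p e hΔ) (pow_sub_one_smul_le p hΔ e e') hy)
      | zero => simp
      | add r s _ _ hr hs =>
        rw [add_smul, map_add]
        exact add_mem (hr y hy) (hs y hy)
      | smul a r _ hr =>
        rw [smul_eq_mul, mul_comm, mul_smul]
        exact hr _ (Submodule.smul_mem _ _ hy)
    | add y _ z _ hy hz =>
      rw [map_add]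
      exact add_mem hy hz
  · obtain ⟨d, hd0, hd⟩ := exists_mul_mem_sections K Δ
    -- `c ^ n` comes from the test relation, and `d` moves `R(⌈qΔ⌉)` into `R((q-1)Δ)`.
    refine ⟨d * c ^ n, mul_ne_zero hd0 (pow_ne_zero _ hc), 0, fun e _ => ?_⟩
    rw [tmul_mem_frobPower_iff]
    have h1 : algebraMap R K (x ^ p ^ e) * algebraMap R K (d * c ^ n) =
        algebraMap R K d * algebraMap R K (c ^ n * x ^ p ^ e) := by
      simp only [map_mul]
      ring
    change algebraMap R K (x ^ p ^ e) * algebraMap R K (d * c ^ n) ∈ _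
    rw [h1]
    have h2 := h e
    generalize algebraMap R K (c ^ n * x ^ p ^ e) = y at h2 ⊢
    induction h2 using Submodule.smul_induction_on' with
    | smul r hr y hy =>
      rw [mul_smul_comm]
      exact Submodule.smul_mem_smul hr (hd _ y hy)
    | add y _ z _ hy hz =>
      rw [mul_add]
      exact add_mem hy hz

end Main

end DeltaTC


theorem mainTheorem9 (p : ℕ) [Fact p.Prime]
    {R : Type*} [CommRing R] [IsDomain R] [IsNoetherianRing R] [IsIntegrallyClosed R] [CharP R p]
    (K : Type*) [Field K] [Algebra R K] [IsFractionRing R K]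
    (hF : DeltaTC.FFinite p R)
    (c : R) (hc : c ≠ 0)
    (hreg : haveI := DeltaTC.charP_away p hc
      DeltaTC.IsStronglyFRegular p (Localization.Away c)) :
    (∀ (Δ : DeltaTC.QDivisor R) (hΔ : 0 ≤ Δ),
      DeltaTC.IsStronglyFRegularPair p K hΔ ↔
        ∃ e : ℕ, DeltaTC.RootSplits p e R
          (DeltaTC.toSections K
            (DeltaTC.roundUp_nonneg (DeltaTC.pow_smul_nonneg p e hΔ)) c)) ∧
    (∀ (Δ : DeltaTC.QDivisor R) (hΔ : 0 ≤ Δ),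
      ∃ n : ℕ, 0 < n ∧ DeltaTC.IsTestElement p K hΔ (c ^ n)) :=
  ⟨fun _ hΔ => DeltaTC.isStronglyFRegularPair_iff hF hc hreg hΔ,
    fun _ hΔ => DeltaTC.exists_isTestElement_pow hF hc hreg hΔ⟩
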